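/- Let $K$ be a field, $X=\mathbb P^1\times\mathbb P^1$ over $K$, and let $K[X]=K[x_0,x_1,y_0,y_1]$ be its coordinate ring, bigraded by $\deg x_i=(1,0)$ and $\deg y_i=(0,1)$. The ideal of a point $P=([a:b],[c:d])$ with coordinates in $K$ is $I(P)=(bx_0-ax_1,\;dy_0-cy_1)$. For a bi-homogeneous ideal $I\subset K[X]$ let $I^{(m)}$ be its $m$-th symbolic power, i.e. the intersection of those components of a primary decomposition of $I^m$ whose radical is contained in an associated prime of $I$; for the ideals considered below, let $\alpha^*(I)$ be the least integer $k\ge 0$ such that $I$ contains a nonzero form of bi-degree $(k,k)$, and let $\gamma^*(I)=\lim_{m\to\infty}\alpha^*(I^{(m)})/m$ be the Waldschmidt constant. Let $P_1,\dots,P_s$ be mutually distinct points of $X$ with coordinates in $K$ and let $I=\bigcap_{i=1}^s I(P_i)\subset K[X]$ be the ideal of their union (for $s=0$, the unit ideal). Then $$\frac{\alpha^*(I^{(m)})}{m}\;\ge\;\frac{\alpha^*(I)}{2}\qquad\text{for all integers } m\ge 1 .$$ Consequently, the limit defining $\gamma^*(I)$ exists and $$\gamma^*(I)\;\ge\;\frac{\alpha^*(I)}{2}.$$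 -/

import Mathlib

open scoped LinearAlgebra.Projectivization

noncomputable section

/-- The symbolic power `I^(m) = ⋂_{P ∈ Ass(R/I)} (I^m R_P ∩ R)`: an element `f` lies in it iff for
every associated prime `P` of `I` some `s ∉ P` satisfies `s * f ∈ I ^ m`.  See
`symbolicPower_eq_of_primaryDecomposition` for its description by primary components. -/
def symbolicPower {R : Type*} [CommRing R] (I : Ideal R) (m : ℕ) : Ideal R where
  carrier := {f | ∀ P ∈ Submodule.associatedPrimes I, ∃ s, s ∉ P ∧ s * f ∈ I ^ m}
  zero_mem' := fun P hP => ⟨1, (Ideal.ne_top_iff_one P).1 hP.1.ne_top, by simp⟩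
  add_mem' := by
    intro f g hf hg P hP
    obtain ⟨s, hs, hsf⟩ := hf P hP
    obtain ⟨t, ht, htg⟩ := hg P hP
    refine ⟨s * t, fun h => (hP.1.mem_or_mem h).elim hs ht, ?_⟩
    have h : s * t * (f + g) = t * (s * f) + s * (t * g) := by ring
    rw [h]
    exact add_mem (Ideal.mul_mem_left _ _ hsf) (Ideal.mul_mem_left _ _ htg)
  smul_mem' := by
    intro c f hf P hP
    obtain ⟨s, hs, hsf⟩ := hf P hP
    refine ⟨s, hs, ?_⟩
    have h : s * (c • f) = c * (s * f) := by simp only [smul_eq_mul]; ring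
    rw [h]
    exact Ideal.mul_mem_left _ _ hsf

/-- For every primary decomposition of `I ^ m`, the symbolic power is the intersection of those
primary components whose radical is contained in an associated prime of `I`. -/
theorem symbolicPower_eq_of_primaryDecomposition {R : Type*} [CommRing R] (I : Ideal R) (m : ℕ)
    (t : Finset (Ideal R)) (ht : ∀ Q ∈ t, Q.IsPrimary) (hI : I ^ m = t.inf id) :
    symbolicPower I m =
      sInf {Q | Q ∈ t ∧ ∃ P ∈ Submodule.associatedPrimes I, Q.radical ≤ P} := by
  classical
  ext f
  rw [Submodule.mem_sInf]
  constructor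
  · rintro hf Q ⟨hQ, P, hP, hle⟩
    obtain ⟨s, hs, hsf⟩ := hf P hP
    have h1 : f * s ∈ Q := by
      have h2 : I ^ m ≤ Q := hI ▸ Finset.inf_le hQ
      exact mul_comm s f ▸ h2 hsf
    rcases (Ideal.isPrimary_iff.1 (ht Q hQ)).2 h1 with h | h
    · exact h
    · exact absurd (hle h) hs
  · intro hf P hP
    have key : ∀ Q ∈ t, ∃ s, s ∉ P ∧ s * f ∈ Q := by
      intro Q hQ
      by_cases hle : ∃ P ∈ Submodule.associatedPrimes I, Q.radical ≤ P
      · exact ⟨1, (Ideal.ne_top_iff_one P).1 hP.1.ne_top, by simpa using hf Q ⟨hQ, hle⟩⟩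
      · have hn : ¬ Q ≤ P := fun h => hle ⟨P, hP, hP.1.radical_le_iff.2 h⟩
        obtain ⟨s, hsQ, hsP⟩ := SetLike.not_le_iff_exists.1 hn
        exact ⟨s, hsP, Ideal.mul_mem_right _ _ hsQ⟩
    choose! s hsP hsf using key
    have := hP.1
    refine ⟨∏ Q ∈ t, s Q, fun h => ?_, ?_⟩
    · obtain ⟨Q, hQ, h⟩ := (Ideal.IsPrime.prod_mem_iff).1 h
      exact hsP Q hQ h
    · rw [hI, Submodule.mem_finsetInf]
      intro Q hQ
      rw [← Finset.mul_prod_erase t s hQ, mul_right_comm]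
      exact Ideal.mul_mem_right _ _ (hsf Q hQ)

namespace BiProj

/-- The surface `ℙ¹ × ℙ¹` over `K` (its `K`-points). -/
abbrev X (K : Type*) [Field K] : Type _ := ℙ K (Fin 2 → K) × ℙ K (Fin 2 → K)

/-- The bi-homogeneous coordinate ring `K[x₀, x₁, y₀, y₁]` of `ℙ¹ × ℙ¹`: the `xᵢ` are the
variables `Sum.inl i`, the `yᵢ` are the variables `Sum.inr i`. -/
abbrev CoordRing (K : Type*) [Field K] : Type _ := MvPolynomial (Fin 2 ⊕ Fin 2) K

/-- The bi-degrees of the variables: `(1, 0)` for `xᵢ` and `(0, 1)` for `yᵢ`. -/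
def bidegree : Fin 2 ⊕ Fin 2 → ℕ × ℕ := Sum.elim (fun _ => (1, 0)) (fun _ => (0, 1))

/-- `f` is a form of bi-degree `(a, b)` (the zero polynomial is one for all `a`, `b`). -/
def IsForm {K : Type*} [Field K] (f : CoordRing K) (a b : ℕ) : Prop :=
  MvPolynomial.IsWeightedHomogeneous bidegree f (a, b)

/-- The ideal `(b x₀ - a x₁, d y₀ - c y₁)` of the point `([a : b], [c : d])`. -/
def pointIdeal {K : Type*} [Field K] (p : X K) : Ideal (CoordRing K) :=
  Ideal.span
    {MvPolynomial.C (p.1.rep 1) * MvPolynomial.X (Sum.inl 0) -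
        MvPolynomial.C (p.1.rep 0) * MvPolynomial.X (Sum.inl 1),
      MvPolynomial.C (p.2.rep 1) * MvPolynomial.X (Sum.inr 0) -
        MvPolynomial.C (p.2.rep 0) * MvPolynomial.X (Sum.inr 1)}

/-- `α*(I)`: the least `k` such that `I` contains a nonzero form of bi-degree `(k, k)`. -/
def alphaStar {K : Type*} [Field K] (I : Ideal (CoordRing K)) : ℕ :=
  sInf {k | ∃ f ∈ I, f ≠ 0 ∧ IsForm f k k}

/-- The Waldschmidt constant `γ*(I) = lim_{m → ∞} α*(I^(m)) / m`. -/
def waldschmidtStar {K : Type*} [Field K] (I : Ideal (CoordRing K)) : ℝ :=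
  Filter.limUnder Filter.atTop (fun m : ℕ => (alphaStar (symbolicPower I m) : ℝ) / m)

end BiProj

end

/-!
The theorem follows from the inequality `m * α*(I) ≤ 2 * α*(I^(m))` (`BiProj.mul_alphaStar_le`):
the function `m ↦ α*(I^(m))` is subadditive, so its quotient by `m` converges by Fekete's lemma, and
the inequality passes to the limit.

The inequality is proved by the Frobenius argument for containment of symbolic powers in Frobenius
powers.  Put `n = α*(I) - 1`, and let `F` be a nonzero form of bi-degree `(d, d)` in `I^(m)`.

*Positive characteristic* (`BiProj.mul_succ_le_of_charP`).  Over a perfect field of characteristic `p`,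
let `q` be a power of `p` and `N` about `2 * q / m`, so that `F ^ N` vanishes to order at least
`2 * q` at every point.  The ideal of a point is generated by two elements `u`, `v`, hence locally
`F ^ N` lies in `(u ^ q, v ^ q)`.  The Cartier operators (`cartierOp`), which extract the components
of a polynomial in the basis of monomials over the ring of `q`-th powers and take their `q`-th roots,
send `(u ^ q, v ^ q)` into `(u, v)`, and one of them does not annihilate `F ^ N`.  The result is a
nonzero form of bi-degree at most `(d * N / q, d * N / q)` in `I`.  Therefore `n + 1 ≤ d * N / q`, and
`q → ∞` gives `m * (n + 1) ≤ 2 * d`.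

*Reduction to positive characteristic* (`BiProj.mul_succ_le`).  The hypotheses are finitely many
polynomial identities and non-vanishings.  In particular the absence of forms of bi-degree `(n, n)`
in `I` amounts to an interpolation formula recovering such forms from their values at the points
(`BiProj.exists_interpolation`).  The data live over a finitely generated subring of the field in
which the relevant nonzero elements are invertible; its residue fields at maximal ideals have
positive characteristic because `ℤ` is a Jacobson ring (`exists_specialization`).

Ideals of points are handled as kernels of the restriction to the cone over the point
(`BiProj.pointIdeal_eq_ker`); since the points are distinct, these ideals are associated primes of
`I`, so elements of `I^(m)` lie locally in their `m`-th powers.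
-/

noncomputable section

universe u

open MvPolynomial

/-! ### Cartier operators -/

section Cartier

variable {σ R : Type*} [CommRing R]

/-- The Cartier operator attached to a residue exponent `e`: it keeps the monomials with exponent
`q • α + e`, replaces that exponent by `α`, and applies `ρ` to the coefficients.  The ring
endomorphism `ρ` stands for the inverse of the `q`-power Frobenius. -/
def cartierOp (ρ : R →+* R) (q : ℕ) [NeZero q] (e : σ →₀ ℕ) :
    MvPolynomial σ R →+ MvPolynomial σ R where
  toFun h := .ofCoeff ((Finsupp.comapDomain (fun α : σ →₀ ℕ => q • α + e)
    (AddMonoidAlgebra.coeff h) (Function.Injective.injOn fun α β hαβ => by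
      ext i
      have := DFunLike.congr_fun hαβ i
      simpa [NeZero.ne q] using this)).mapRange ρ (map_zero ρ))
  map_zero' := by
    refine MvPolynomial.ext _ _ fun α => ?_
    exact map_zero ρ
  map_add' f g := by
    refine MvPolynomial.ext _ _ fun α => ?_
    rw [coeff_add]
    exact (congrArg ρ (coeff_add _ f g)).trans (map_add ρ _ _)

theorem coeff_cartierOp (ρ : R →+* R) (q : ℕ) [NeZero q] (e α : σ →₀ ℕ) (h : MvPolynomial σ R) :
    coeff α (cartierOp ρ q e h) = ρ (coeff (q • α + e) h) := rfl

/-- The Cartier operators are linear over the `q`-th powers. -/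
theorem cartierOp_pow_mul {p : ℕ} [ExpChar R p] (n : ℕ) [NeZero (p ^ n)] (ρ : R →+* R)
    (hρ : ∀ c, ρ (c ^ p ^ n) = c) (e : σ →₀ ℕ) (he : ∀ i, e i < p ^ n)
    (g h : MvPolynomial σ R) :
    cartierOp ρ (p ^ n) e (g ^ p ^ n * h) = g * cartierOp ρ (p ^ n) e h := by
  induction g using MvPolynomial.monomial_add_induction_on with
  | C a =>
    ext α
    rw [← map_pow, coeff_cartierOp, coeff_C_mul, coeff_C_mul, map_mul, hρ, coeff_cartierOp]
  | monomial_add a b f ha hb ih =>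
    have key : cartierOp ρ (p ^ n) e ((monomial a b) ^ p ^ n * h) =
        monomial a b * cartierOp ρ (p ^ n) e h := by
      ext α
      rw [monomial_pow, coeff_cartierOp, coeff_monomial_mul', coeff_monomial_mul', coeff_cartierOp]
      have hle : p ^ n • a ≤ p ^ n • α + e ↔ a ≤ α := by
        constructor
        · intro H i
          have h1 := H i
          simp only [Finsupp.coe_add, Finsupp.coe_smul, Pi.add_apply, Pi.smul_apply,
            smul_eq_mul] at h1
          by_contra! hlt
          have h2 := Nat.mul_le_mul_left (p ^ n) hlt
          have h3 := he i
          rw [Nat.succ_eq_add_one, mul_add] at h2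
          omega
        · intro H i
          have h1 := Nat.mul_le_mul_left (p ^ n) (H i)
          simp only [Finsupp.coe_add, Finsupp.coe_smul, Pi.add_apply, Pi.smul_apply,
            smul_eq_mul]
          omega
      by_cases hα : a ≤ α
      · rw [if_pos (hle.2 hα), if_pos hα, map_mul, hρ]
        obtain ⟨β, rfl⟩ := exists_add_of_le hα
        congr 3
        rw [add_tsub_cancel_left, smul_add, add_assoc, add_tsub_cancel_left]
      · rw [if_neg (hle.not.2 hα), if_neg hα, map_zero]
    rw [add_pow_expChar_pow, add_mul, map_add, key, ih, add_mul]

/-- A nonzero polynomial is not annihilated by all Cartier operators. -/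
theorem exists_cartierOp_ne_zero {ρ : R →+* R} (hρ : Function.Injective ρ) (q : ℕ) [NeZero q]
    {h : MvPolynomial σ R} (hh : h ≠ 0) :
    ∃ e : σ →₀ ℕ, (∀ i, e i < q) ∧ cartierOp ρ q e h ≠ 0 := by
  obtain ⟨β, hβ⟩ := MvPolynomial.ne_zero_iff.1 hh
  refine ⟨β.mapRange (· % q) (Nat.zero_mod q), fun i => Nat.mod_lt _ (NeZero.pos q),
    MvPolynomial.ne_zero_iff.2 ⟨β.mapRange (· / q) (Nat.zero_div q), ?_⟩⟩
  rw [coeff_cartierOp]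
  have : q • β.mapRange (· / q) (Nat.zero_div q) + β.mapRange (· % q) (Nat.zero_mod q) = β := by
    ext i
    simp [Nat.div_add_mod]
  rw [this]
  exact fun h0 => hβ (hρ (h0.trans (map_zero ρ).symm))

/-- Cartier operators divide bi-degrees by `q`. -/
theorem cartierOp_isWeightedHomogeneous {w : σ → ℕ × ℕ} {D : ℕ × ℕ} (ρ : R →+* R) (q : ℕ)
    [NeZero q] (e : σ →₀ ℕ) {h : MvPolynomial σ R} (hh : IsWeightedHomogeneous w h D)
    (h0 : cartierOp ρ q e h ≠ 0) :
    ∃ b : ℕ × ℕ, IsWeightedHomogeneous w (cartierOp ρ q e h) b ∧ q • b ≤ D := by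
  have key : ∀ α, coeff α (cartierOp ρ q e h) ≠ 0 →
      q • Finsupp.weight w α + Finsupp.weight w e = D := by
    intro α hα
    rw [coeff_cartierOp] at hα
    have := hh (d := q • α + e) fun h0 => hα (by rw [h0, map_zero])
    rwa [map_add, map_nsmul] at this
  obtain ⟨β, hβ⟩ := MvPolynomial.ne_zero_iff.1 h0
  refine ⟨Finsupp.weight w β, fun α hα => ?_, le_of_le_of_eq le_self_add (key β hβ)⟩
  have := add_right_cancel ((key α hα).trans (key β hβ).symm)
  simpa [Prod.ext_iff, NeZero.ne q] using this

end Cartier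

/-! ### Specialization to positive characteristic -/

theorem Int.isJacobsonRing : IsJacobsonRing ℤ := by
  refine isJacobsonRing_iff_prime_eq.2 fun P hP => ?_
  by_cases h : P = ⊥
  · subst h
    refine le_antisymm (fun x hx => ?_) Ideal.le_jacobson
    have := Int.isUnit_iff.1 (Ideal.mem_jacobson_bot.1 hx (2 * x))
    rw [Ideal.mem_bot]
    by_contra h0
    have : 0 < x * x := mul_self_pos.2 h0
    rcases ‹_ ∨ _› with h | h <;> nlinarith
  · have := hP.isMaximal h
    exact Ideal.jacobson_eq_self_of_isMaximal

/-- Given finitely many elements of a field, some subring containing them maps to an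
algebraically closed field of positive characteristic without killing any of the nonzero ones. -/
theorem exists_specialization {K : Type u} [Field K] (S : Set K) (hS : S.Finite) :
    ∃ (B : Subring K) (k : Type u) (_ : Field k) (_ : IsAlgClosed k) (p : ℕ) (_ : Fact p.Prime)
      (_ : CharP k p) (θ : B →+* k), S ⊆ B ∧ ∀ x : B, (x : K) ∈ S → x ≠ 0 → θ x ≠ 0 := by
  -- Adjoining the inverses keeps the nonzero elements of `S` out of every maximal ideal.
  let A := Algebra.adjoin ℤ (S ∪ (fun x => x⁻¹) '' S)
  have hA : Algebra.FiniteType ℤ A :=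
    (Subalgebra.fg_iff_finiteType A).1 (Subalgebra.fg_def.2 ⟨_, hS.union (hS.image _), rfl⟩)
  obtain ⟨M, hM⟩ := Ideal.exists_maximal A
  let _ : Field (A ⧸ M) := Ideal.Quotient.field M
  have : Algebra.FiniteType ℤ (A ⧸ M) := inferInstance
  have := Int.isJacobsonRing
  have hfin : Module.Finite ℤ (A ⧸ M) := finite_of_finite_type_of_isJacobsonRing ℤ (A ⧸ M)
  obtain ⟨p, hp⟩ := CharP.exists (A ⧸ M)
  have hp0 : p ≠ 0 := by
    -- A field of characteristic zero is not integral over the non-field `ℤ`.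
    rintro rfl
    have : CharZero (A ⧸ M) := CharP.charP_to_charZero _
    have hint : Algebra.IsIntegral ℤ (A ⧸ M) := inferInstance
    exact Int.not_isField (isField_of_isIntegral_of_isField
      (FaithfulSMul.algebraMap_injective ℤ (A ⧸ M)) (Field.toIsField _))
  have hpp : Fact p.Prime := ⟨(CharP.char_is_prime_or_zero (A ⧸ M) p).resolve_right hp0⟩
  refine ⟨A.toSubring, AlgebraicClosure (A ⧸ M), inferInstance, inferInstance, p, hpp,
    charP_of_injective_algebraMap (algebraMap (A ⧸ M) (AlgebraicClosure (A ⧸ M))).injective p,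
    (algebraMap (A ⧸ M) (AlgebraicClosure (A ⧸ M))).comp (Ideal.Quotient.mk M),
    fun x hx => Algebra.subset_adjoin (Or.inl hx), fun x hx hx0 => ?_⟩
  have hinv : (x : K)⁻¹ ∈ A := Algebra.subset_adjoin (Or.inr ⟨x, hx, rfl⟩)
  have hu : (x : A) * (⟨(x : K)⁻¹, hinv⟩ : A) = 1 :=
    Subtype.ext (mul_inv_cancel₀ fun h => hx0 (Subtype.ext h))
  exact ((IsUnit.of_mul_eq_one _ hu).map _).ne_zero

/-! ### The cone over a point of `ℙ¹ × ℙ¹` -/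

namespace BiProj

section Cone

variable {R S : Type*} [CommRing R] [CommRing S]

/-- The linear form of bi-degree `(1, 0)` vanishing at the point with coordinates `z`. -/
def formX (z : Fin 2 ⊕ Fin 2 → R) : MvPolynomial (Fin 2 ⊕ Fin 2) R :=
  C (z (Sum.inl 1)) * MvPolynomial.X (Sum.inl 0) - C (z (Sum.inl 0)) * MvPolynomial.X (Sum.inl 1)

/-- The linear form of bi-degree `(0, 1)` vanishing at the point with coordinates `z`. -/
def formY (z : Fin 2 ⊕ Fin 2 → R) : MvPolynomial (Fin 2 ⊕ Fin 2) R :=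
  C (z (Sum.inr 1)) * MvPolynomial.X (Sum.inr 0) - C (z (Sum.inr 0)) * MvPolynomial.X (Sum.inr 1)

/-- The ideal of the point with coordinates `z`, over an arbitrary ring and for an arbitrary vector
of bi-homogeneous coordinates. -/
def coneIdeal (z : Fin 2 ⊕ Fin 2 → R) : Ideal (MvPolynomial (Fin 2 ⊕ Fin 2) R) :=
  Ideal.span {formX z, formY z}

/-- Restriction of a polynomial to the cone `{(l a₀, l a₁, m b₀, m b₁)}` over the point with
coordinates `z = (a₀, a₁, b₀, b₁)`; the parameters `l` and `m` are the variables of the target. -/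
def coneMap (z : Fin 2 ⊕ Fin 2 → R) :
    MvPolynomial (Fin 2 ⊕ Fin 2) R →ₐ[R] MvPolynomial (Fin 2) R :=
  aeval fun v => C (z v) * MvPolynomial.X (Sum.elim (fun _ => 0) (fun _ => 1) v)

theorem coneMap_X (z : Fin 2 ⊕ Fin 2 → R) (v : Fin 2 ⊕ Fin 2) :
    coneMap z (MvPolynomial.X v) =
      C (z v) * MvPolynomial.X (Sum.elim (fun _ => 0) (fun _ => 1) v) :=
  aeval_X _ _

theorem coneMap_C (z : Fin 2 ⊕ Fin 2 → R) (c : R) : coneMap z (C c) = C c :=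
  aeval_C _ _

theorem coneMap_formX (z w : Fin 2 ⊕ Fin 2 → R) : coneMap z (formX w) =
    C (w (Sum.inl 1) * z (Sum.inl 0) - w (Sum.inl 0) * z (Sum.inl 1)) * MvPolynomial.X 0 := by
  simp only [formX, map_sub, map_mul, coneMap_X, coneMap_C, Sum.elim_inl]
  ring

theorem coneMap_formY (z w : Fin 2 ⊕ Fin 2 → R) : coneMap z (formY w) =
    C (w (Sum.inr 1) * z (Sum.inr 0) - w (Sum.inr 0) * z (Sum.inr 1)) * MvPolynomial.X 1 := by
  simp only [formY, map_sub, map_mul, coneMap_X, coneMap_C, Sum.elim_inr]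
  ring

theorem coneMap_formX_self (z : Fin 2 ⊕ Fin 2 → R) : coneMap z (formX z) = 0 := by
  rw [coneMap_formX, mul_comm (z _), sub_self, C_0, zero_mul]

theorem coneMap_formY_self (z : Fin 2 ⊕ Fin 2 → R) : coneMap z (formY z) = 0 := by
  rw [coneMap_formY, mul_comm (z _), sub_self, C_0, zero_mul]

theorem coneIdeal_le_ker (z : Fin 2 ⊕ Fin 2 → R) : coneIdeal z ≤ RingHom.ker (coneMap z) := by
  rw [coneIdeal, Ideal.span_le]
  rintro f (rfl | rfl)
  · exact coneMap_formX_self z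
  · exact coneMap_formY_self z

theorem eval_one_coneMap (z : Fin 2 ⊕ Fin 2 → R) (h : MvPolynomial (Fin 2 ⊕ Fin 2) R) :
    eval 1 (coneMap z h) = eval z h := by
  have : ((aeval (1 : Fin 2 → R)).comp (coneMap z)) = aeval z := by
    refine algHom_ext fun v => ?_
    simp [coneMap_X]
  simpa using DFunLike.congr_fun this h

theorem map_coneMap (f : R →+* S) (z : Fin 2 ⊕ Fin 2 → R) (h : MvPolynomial (Fin 2 ⊕ Fin 2) R) :
    map f (coneMap z h) = coneMap (f ∘ z) (map f h) := by
  induction h using MvPolynomial.induction_on with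
  | C a => simp
  | add p q hp hq => simp only [map_add, hp, hq]
  | mul_X p v hp => simp only [map_mul, hp, coneMap_X, map_X, map_C, Function.comp_apply]

theorem map_formX (f : R →+* S) (z : Fin 2 ⊕ Fin 2 → R) : map f (formX z) = formX (f ∘ z) := by
  simp [formX]

theorem map_formY (f : R →+* S) (z : Fin 2 ⊕ Fin 2 → R) : map f (formY z) = formY (f ∘ z) := by
  simp [formY]

/-- On the cone over `z`, a form of bi-degree `(a, b)` is its value at `z` times `l ^ a * m ^ b`. -/
theorem coneMap_eq_of_isWeightedHomogeneous (z : Fin 2 ⊕ Fin 2 → R) {a b : ℕ}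
    {h : MvPolynomial (Fin 2 ⊕ Fin 2) R} (hh : IsWeightedHomogeneous bidegree h (a, b)) :
    coneMap z h = C (eval z h) * (MvPolynomial.X 0 ^ a * MvPolynomial.X 1 ^ b) := by
  induction hh using IsWeightedHomogeneous.induction_on with
  | zero => simp
  | add p q hp hq ihp ihq => rw [map_add, ihp, ihq, map_add, C_add, add_mul]
  | monomial d r hr =>
    have h1 : d (Sum.inl 0) + d (Sum.inl 1) = a ∧ d (Sum.inr 0) + d (Sum.inr 1) = b := by
      simpa [Finsupp.weight_apply, Finsupp.sum_fintype, bidegree, -nsmul_eq_mul] using hr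
    rw [← h1.1, ← h1.2, coneMap, aeval_monomial, eval_monomial]
    simp only [Finsupp.prod_fintype _ _ fun _ => pow_zero _, Fintype.prod_sum_type,
      Fin.prod_univ_two, Sum.elim_inl, Sum.elim_inr, algebraMap_eq, map_mul, map_pow]
    ring

end Cone

/-! ### The bound in positive characteristic -/

section CharP

variable {k : Type*} [Field k] {p : ℕ} [Fact p.Prime] [CharP k p]

/-- Cartier operators of exponent `q` send an element vanishing to order `2 * q` at a point to one
vanishing at that point: `(u, v) ^ (2 * q)` is contained in `(u ^ q, v ^ q)`. -/
theorem coneMap_cartierOp_eq_zero {n : ℕ} [NeZero (p ^ n)] {ρ : k →+* k}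
    (hρ : ∀ c, ρ (c ^ p ^ n) = c) {e : Fin 2 ⊕ Fin 2 →₀ ℕ} (he : ∀ i, e i < p ^ n)
    {z : Fin 2 ⊕ Fin 2 → k} {h : MvPolynomial (Fin 2 ⊕ Fin 2) k}
    (hh : h ∈ coneIdeal z ^ (p ^ n + p ^ n)) : coneMap z (cartierOp ρ (p ^ n) e h) = 0 := by
  rw [coneIdeal, Ideal.span_insert] at hh
  have h1 := Ideal.sup_pow_add_le_pow_sup_pow hh
  rw [Ideal.span_singleton_pow, Ideal.span_singleton_pow, ← Ideal.span_insert,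
    Ideal.mem_span_pair] at h1
  obtain ⟨a, b, rfl⟩ := h1
  rw [mul_comm a, mul_comm b, map_add, cartierOp_pow_mul n ρ hρ e he,
    cartierOp_pow_mul n ρ hρ e he, map_add, map_mul, map_mul, coneMap_formX_self,
    coneMap_formY_self, zero_mul, zero_mul, add_zero]

/-- In positive characteristic, if no nonzero form of bi-degree `(n, n)` vanishes at the given
points, then a form of bi-degree `(d, d)` vanishing to order `m` at all of them satisfies
`m * (n + 1) ≤ 2 * d`.  Vanishing to order `m` is expressed after localizing at the point. -/
theorem mul_succ_le_of_charP [IsAlgClosed k] (p : ℕ) [Fact p.Prime] [CharP k p]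
    {ι : Type*} {z : ι → Fin 2 ⊕ Fin 2 → k} {m n d : ℕ} (hm : 0 < m)
    (hn : ∀ G : MvPolynomial (Fin 2 ⊕ Fin 2) k, IsWeightedHomogeneous bidegree G (n, n) →
      (∀ i, eval (z i) G = 0) → G = 0)
    {F : MvPolynomial (Fin 2 ⊕ Fin 2) k} (hF0 : F ≠ 0)
    (hF : IsWeightedHomogeneous bidegree F (d, d)) {s : ι → MvPolynomial (Fin 2 ⊕ Fin 2) k}
    (hs : ∀ i, coneMap (z i) (s i) ≠ 0) (hsF : ∀ i, s i * F ∈ coneIdeal (z i) ^ m) :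
    m * (n + 1) ≤ 2 * d := by
  -- Large powers `q` of `p` make the rounding error `d * m` below negligible.
  obtain ⟨e, he⟩ : ∃ e, d * m < p ^ e := ⟨d * m, Nat.lt_pow_self (Fact.out : p.Prime).one_lt⟩
  have hq0 : NeZero (p ^ e) := ⟨(pow_pos (Fact.out : p.Prime).pos e).ne'⟩
  set q := p ^ e with hq
  let N := 2 * q / m + 1
  have hN1 : 2 * q ≤ m * N := (Nat.lt_mul_div_succ (2 * q) hm).le
  have hN2 : m * N ≤ 2 * q + m := by
    have := Nat.mul_div_le (2 * q) m
    simp only [N, mul_add, mul_one]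
    omega
  let ρ : k →+* k := (iterateFrobeniusEquiv k p e).symm
  have hρ : ∀ c, ρ (c ^ p ^ e) = c := fun c => (iterateFrobeniusEquiv k p e).symm_apply_apply c
  obtain ⟨r, hr, hT0⟩ := exists_cartierOp_ne_zero (ρ := ρ)
    (iterateFrobeniusEquiv k p e).symm.injective q (pow_ne_zero N hF0)
  obtain ⟨⟨b, c⟩, hT, hbc⟩ := cartierOp_isWeightedHomogeneous ρ q r (hF.pow N) hT0
  set G := cartierOp ρ q r (F ^ N)
  have hG : ∀ i, eval (z i) G = 0 := by
    intro i
    rw [← eval_one_coneMap]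
    -- The multiplier enters as a `q`-th power, so that it can be pulled out of the Cartier operator.
    have h1 : (s i ^ N) ^ q * F ^ N ∈ coneIdeal (z i) ^ (q + q) := by
      have h2 := Ideal.pow_le_pow_right (I := coneIdeal (z i)) (m := q + q) (n := m * N)
        (by omega) (pow_mul (coneIdeal (z i)) m N ▸ Ideal.pow_mem_pow (hsF i) N)
      obtain ⟨j, hj⟩ := Nat.exists_eq_add_of_le (Nat.le_mul_of_pos_right N (NeZero.pos q))
      rw [← pow_mul, hj, pow_add (s i), mul_right_comm, ← mul_pow]
      exact Ideal.mul_mem_right _ _ h2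
    have h2 := coneMap_cartierOp_eq_zero hρ hr h1
    rw [cartierOp_pow_mul e ρ hρ r hr, map_mul, map_pow] at h2
    rw [(mul_eq_zero.1 h2).resolve_left (pow_ne_zero _ (hs i)), map_zero]
  obtain ⟨hb, hc⟩ : q * b ≤ N * d ∧ q * c ≤ N * d := by
    simpa [Prod.le_def] using hbc
  have hlarge : n + 1 ≤ max b c := by
    -- Otherwise `G` could be multiplied by monomials up to the bi-degree `(n, n)`.
    by_contra! hlt
    have h1 : IsWeightedHomogeneous bidegree
        (MvPolynomial.X (Sum.inl 0) ^ (n - b) * MvPolynomial.X (Sum.inr 0) ^ (n - c) * G) (n, n) := by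
      have := (((isWeightedHomogeneous_X k bidegree (Sum.inl 0)).pow (n - b)).mul
        ((isWeightedHomogeneous_X k bidegree (Sum.inr 0)).pow (n - c))).mul hT
      have hw : (n - b) • bidegree (Sum.inl 0) + (n - c) • bidegree (Sum.inr 0) + (b, c) =
          (n, n) := by
        simp only [bidegree, Sum.elim_inl, Sum.elim_inr, Prod.smul_mk, Prod.mk_add_mk, smul_eq_mul,
          Prod.mk.injEq]
        omega
      rwa [hw] at this
    refine mul_ne_zero (mul_ne_zero (pow_ne_zero _ (X_ne_zero _)) (pow_ne_zero _ (X_ne_zero _)))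
      hT0 (hn _ h1 fun i => ?_)
    rw [map_mul, hG, mul_zero]
  have h1 : q * (n + 1) ≤ N * d :=
    (Nat.mul_le_mul_left q hlarge).trans (by rcases max_choice b c with h | h <;> rwa [h])
  -- If `2 * d < m * (n + 1)`, comparing with `m * N ≤ 2 * q + m` forces `q ≤ d * m`.
  by_contra! hlt
  have h2 : q * (2 * d + 1) ≤ d * (2 * q + m) := calc
    q * (2 * d + 1) ≤ q * (m * (n + 1)) := Nat.mul_le_mul_left q hlt
    _ = m * (q * (n + 1)) := by ring
    _ ≤ m * (N * d) := Nat.mul_le_mul_left m h1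
    _ = d * (m * N) := by ring
    _ ≤ d * (2 * q + m) := Nat.mul_le_mul_left d hN2
  linarith

end CharP

/-! ### Ideals of points -/

section Points

variable {K : Type*} [Field K]

/-- Bi-homogeneous coordinates of a point of `ℙ¹ × ℙ¹`. -/
def coords (P : X K) : Fin 2 ⊕ Fin 2 → K := Sum.elim P.1.rep P.2.rep

theorem pointIdeal_eq_coneIdeal (P : X K) : pointIdeal P = coneIdeal (coords P) := rfl

/-- An ideal containing the determinant of the matrix with rows `a` and `x` contains all its minors,
also those with repeated or exchanged columns. -/
theorem minor_mem {R : Type*} [CommRing R] {J : Ideal R} {a x : Fin 2 → R}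
    (h : a 1 * x 0 - a 0 * x 1 ∈ J) (i l : Fin 2) : a i * x l - a l * x i ∈ J := by
  fin_cases i <;> fin_cases l
  · simp
  · simpa using neg_mem h
  · exact h
  · simp

/-- The ideal of a point consists of the polynomials vanishing on the cone over it. -/
theorem pointIdeal_eq_ker (P : X K) : pointIdeal P = RingHom.ker (coneMap (coords P)) := by
  refine le_antisymm (coneIdeal_le_ker (coords P)) fun h hh => ?_
  obtain ⟨i, hi⟩ := Function.ne_iff.1 P.1.rep_nonzero
  obtain ⟨j, hj⟩ := Function.ne_iff.1 P.2.rep_nonzero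
  have hX : ∀ l, C (P.1.rep i) * MvPolynomial.X (Sum.inl l) -
      C (P.1.rep l) * MvPolynomial.X (Sum.inl i) ∈ pointIdeal P :=
    fun l => minor_mem (a := fun l => C (P.1.rep l)) (x := fun l => MvPolynomial.X (Sum.inl l))
      (Ideal.subset_span (Or.inl rfl)) i l
  have hY : ∀ l, C (P.2.rep j) * MvPolynomial.X (Sum.inr l) -
      C (P.2.rep l) * MvPolynomial.X (Sum.inr j) ∈ pointIdeal P :=
    fun l => minor_mem (a := fun l => C (P.2.rep l)) (x := fun l => MvPolynomial.X (Sum.inr l))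
      (Ideal.subset_span (Or.inr rfl)) j l
  -- Modulo the ideal, the cone parameters are recovered from the variables `xᵢ` and `yⱼ`.
  let ψ : MvPolynomial (Fin 2) K →ₐ[K] CoordRing K := aeval
    ![C (P.1.rep i)⁻¹ * MvPolynomial.X (Sum.inl i), C (P.2.rep j)⁻¹ * MvPolynomial.X (Sum.inr j)]
  have hψ : ((Ideal.Quotient.mkₐ K (pointIdeal P)).comp ψ).comp (coneMap (coords P)) =
      Ideal.Quotient.mkₐ K (pointIdeal P) := by
    refine algHom_ext fun v => ?_
    rw [AlgHom.comp_apply, AlgHom.comp_apply, coneMap_X, Ideal.Quotient.mkₐ_eq_mk]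
    symm
    rw [Ideal.Quotient.eq]
    rcases v with l | l
    · convert Ideal.mul_mem_left _ (C (P.1.rep i)⁻¹) (hX l) using 1
      have : C (P.1.rep i)⁻¹ * C (P.1.rep i) = (1 : CoordRing K) := by
        rw [← C_mul, inv_mul_cancel₀ hi, C_1]
      simp only [ψ, coords, map_mul, aeval_X, Sum.elim_inl, Matrix.cons_val_zero, mul_sub,
        ← mul_assoc, this, one_mul, algHom_C, algebraMap_eq]
      ring
    · convert Ideal.mul_mem_left _ (C (P.2.rep j)⁻¹) (hY l) using 1
      have : C (P.2.rep j)⁻¹ * C (P.2.rep j) = (1 : CoordRing K) := by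
        rw [← C_mul, inv_mul_cancel₀ hj, C_1]
      simp only [ψ, coords, map_mul, aeval_X, Sum.elim_inr, Matrix.cons_val_one, mul_sub,
        ← mul_assoc, this, one_mul, algHom_C, algebraMap_eq, Matrix.cons_val_fin_one]
      ring
  have h1 := AlgHom.congr_fun hψ h
  rw [AlgHom.comp_apply, RingHom.mem_ker.1 hh, map_zero] at h1
  exact Ideal.Quotient.eq_zero_iff_mem.1 h1.symm

theorem pointIdeal_isPrime (P : X K) : (pointIdeal P).IsPrime := by
  rw [pointIdeal_eq_ker]
  exact RingHom.ker_isPrime _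

theorem mem_pointIdeal_iff_eval_eq_zero (P : X K) {f : CoordRing K} {a b : ℕ}
    (hf : IsForm f a b) : f ∈ pointIdeal P ↔ eval (coords P) f = 0 := by
  rw [pointIdeal_eq_ker, RingHom.mem_ker]
  constructor
  · intro h
    rw [← eval_one_coneMap, h, map_zero]
  · intro h
    rw [coneMap_eq_of_isWeightedHomogeneous _ hf, h, C_0, zero_mul]

/-- Points of the projective line with proportional coordinate vectors agree. -/
theorem projectivization_eq_of_det_eq_zero {v w : ℙ K (Fin 2 → K)}
    (h : w.rep 1 * v.rep 0 - w.rep 0 * v.rep 1 = 0) : v = w := by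
  rw [← v.mk_rep, ← w.mk_rep, Projectivization.mk_eq_mk_iff']
  obtain ⟨i, hi⟩ := Function.ne_iff.1 w.rep_nonzero
  rw [Pi.zero_apply] at hi
  refine ⟨v.rep i / w.rep i, funext fun j => ?_⟩
  rw [Pi.smul_apply, smul_eq_mul, div_mul_eq_mul_div, div_eq_iff hi]
  fin_cases i <;> fin_cases j <;> simp <;>
    first | linear_combination h | linear_combination -h

theorem pointIdeal_le_iff {P Q : X K} : pointIdeal P ≤ pointIdeal Q ↔ P = Q := by
  refine ⟨fun h => ?_, fun h => h ▸ le_rfl⟩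
  rw [pointIdeal_eq_ker Q, pointIdeal_eq_coneIdeal] at h
  have hX : coneMap (coords Q) (formX (coords P)) = 0 := h (Ideal.subset_span (by simp))
  have hY : coneMap (coords Q) (formY (coords P)) = 0 := h (Ideal.subset_span (by simp))
  rw [coneMap_formX] at hX
  rw [coneMap_formY] at hY
  have hX' := C_eq_zero.1 ((mul_eq_zero.1 hX).resolve_right (X_ne_zero _))
  have hY' := C_eq_zero.1 ((mul_eq_zero.1 hY).resolve_right (X_ne_zero _))
  exact (Prod.ext (projectivization_eq_of_det_eq_zero hX')
    (projectivization_eq_of_det_eq_zero hY')).symm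

/-- The ideal of each point is an associated prime of the ideal of the union. -/
theorem pointIdeal_mem_associatedPrimes {s : ℕ} {P : Fin s → X K} (hP : Function.Injective P)
    (i : Fin s) :
    pointIdeal (P i) ∈ Submodule.associatedPrimes (⨅ j, pointIdeal (P j)) := by
  have hprime := pointIdeal_isPrime (P i)
  have hsep : ∀ j, ∃ g, j ≠ i → g ∈ pointIdeal (P j) ∧ g ∉ pointIdeal (P i) := by
    intro j
    by_cases hj : j = i
    · exact ⟨0, fun h => absurd hj h⟩
    · obtain ⟨g, hg⟩ := SetLike.not_le_iff_exists.1
        (mt pointIdeal_le_iff.1 fun h => hj (hP h))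
      exact ⟨g, fun _ => hg⟩
  choose g hg using hsep
  refine ⟨hprime, ∏ j ∈ Finset.univ.erase i, g j, ?_⟩
  have hcolon : (⨅ j, pointIdeal (P j)).colon {∏ j ∈ Finset.univ.erase i, g j} =
      pointIdeal (P i) := by
    ext a
    rw [Submodule.mem_colon_singleton, smul_eq_mul, Submodule.mem_iInf]
    constructor
    · intro h
      refine (hprime.mem_or_mem (h i)).resolve_right fun h' => ?_
      obtain ⟨j, hj, hgj⟩ := Ideal.IsPrime.prod_mem_iff.1 h'
      exact (hg j (Finset.ne_of_mem_erase hj)).2 hgj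
    · intro h j
      by_cases hj : j = i
      · rw [hj]
        exact Ideal.mul_mem_right _ _ h
      · exact Ideal.mul_mem_left _ _ (Ideal.mem_of_dvd _
          (Finset.dvd_prod_of_mem g (Finset.mem_erase.2 ⟨hj, Finset.mem_univ j⟩)) (hg j hj).1)
  rw [hcolon, hprime.radical]

/-- Elements of the symbolic power vanish to order `m` at every point. -/
theorem exists_mul_mem_pow_of_mem_symbolicPower {s : ℕ} {P : Fin s → X K}
    (hP : Function.Injective P) {m : ℕ} {f : CoordRing K}
    (hf : f ∈ symbolicPower (⨅ j, pointIdeal (P j)) m) (i : Fin s) :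
    ∃ g, coneMap (coords (P i)) g ≠ 0 ∧ g * f ∈ coneIdeal (coords (P i)) ^ m := by
  obtain ⟨g, hg, hgf⟩ := hf _ (pointIdeal_mem_associatedPrimes hP i)
  rw [pointIdeal_eq_ker] at hg
  exact ⟨g, hg, Ideal.pow_right_mono (iInf_le _ i) m hgf⟩

end Points

/-! ### Forms in symbolic powers -/

section Forms

variable {K : Type*} [Field K]

theorem alphaStar_le {I : Ideal (CoordRing K)} {f : CoordRing K} {d : ℕ} (hf : f ∈ I) (h0 : f ≠ 0)
    (hd : IsForm f d d) : alphaStar I ≤ d :=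
  Nat.sInf_le ⟨f, hf, h0, hd⟩

/-- Once an ideal contains a form of balanced bi-degree, the infimum `alphaStar` is attained. -/
theorem exists_form_alphaStar {I : Ideal (CoordRing K)} (h : ∃ d, ∃ f ∈ I, f ≠ 0 ∧ IsForm f d d) :
    ∃ f ∈ I, f ≠ 0 ∧ IsForm f (alphaStar I) (alphaStar I) :=
  Nat.sInf_mem (s := {k | ∃ f ∈ I, f ≠ 0 ∧ IsForm f k k}) h

theorem IsForm.mul {f g : CoordRing K} {a b c d : ℕ} (hf : IsForm f a b) (hg : IsForm g c d) :
    IsForm (f * g) (a + c) (b + d) :=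
  IsWeightedHomogeneous.mul hf hg

theorem pow_le_symbolicPower {R : Type*} [CommRing R] (I : Ideal R) (m : ℕ) :
    I ^ m ≤ symbolicPower I m := fun f hf P hP =>
  ⟨1, (Ideal.ne_top_iff_one P).1 hP.1.ne_top, by rwa [one_mul]⟩

theorem mul_mem_symbolicPower {R : Type*} [CommRing R] {I : Ideal R} {m n : ℕ} {f g : R}
    (hf : f ∈ symbolicPower I m) (hg : g ∈ symbolicPower I n) :
    f * g ∈ symbolicPower I (m + n) := by
  intro P hP
  obtain ⟨s, hs, hsf⟩ := hf P hP
  obtain ⟨t, ht, htg⟩ := hg P hP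
  refine ⟨s * t, fun h => (hP.1.mem_or_mem h).elim hs ht, ?_⟩
  rw [mul_mul_mul_comm, pow_add]
  exact Ideal.mul_mem_mul hsf htg

theorem formX_ne_zero (P : X K) : formX (coords P) ≠ 0 := by
  intro h
  refine P.1.rep_nonzero (funext fun i => ?_)
  have h0 := congrArg (coeff (Finsupp.single (Sum.inl 0) 1)) h
  have h1 := congrArg (coeff (Finsupp.single (Sum.inl 1) 1)) h
  simp [formX, coords, coeff_C_mul, coeff_X, Finsupp.single_left_inj] at h0 h1
  fin_cases i <;> assumption

theorem formY_ne_zero (P : X K) : formY (coords P) ≠ 0 := by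
  intro h
  refine P.2.rep_nonzero (funext fun i => ?_)
  have h0 := congrArg (coeff (Finsupp.single (Sum.inr 0) 1)) h
  have h1 := congrArg (coeff (Finsupp.single (Sum.inr 1) 1)) h
  simp [formY, coords, coeff_C_mul, coeff_X, Finsupp.single_left_inj] at h0 h1
  fin_cases i <;> assumption

theorem isForm_formX (z : Fin 2 ⊕ Fin 2 → K) : IsForm (formX z) 1 0 :=
  ((isWeightedHomogeneous_X K bidegree (Sum.inl 0)).C_mul _).sub
    ((isWeightedHomogeneous_X K bidegree (Sum.inl 1)).C_mul _)

theorem isForm_formY (z : Fin 2 ⊕ Fin 2 → K) : IsForm (formY z) 0 1 :=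
  ((isWeightedHomogeneous_X K bidegree (Sum.inr 0)).C_mul _).sub
    ((isWeightedHomogeneous_X K bidegree (Sum.inr 1)).C_mul _)

/-- The product of the lines of both rulings through the points lies in the ideal of the points;
its powers lie in the symbolic powers, which therefore contain forms of balanced bi-degree. -/
theorem exists_form_mem_symbolicPower {s : ℕ} (P : Fin s → X K) (m : ℕ) :
    ∃ d, ∃ f ∈ symbolicPower (⨅ j, pointIdeal (P j)) m, f ≠ 0 ∧ IsForm f d d := by
  let f : CoordRing K := ∏ i, formX (coords (P i)) * formY (coords (P i))
  have hf : IsForm f s s := by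
    have := IsWeightedHomogeneous.prod Finset.univ
      (fun i => formX (coords (P i)) * formY (coords (P i))) (fun _ => (1, 1))
      (w := bidegree) fun i _ => (isForm_formX _).mul (isForm_formY _)
    simpa [IsForm, f] using this
  refine ⟨m * s, f ^ m, pow_le_symbolicPower _ _ (Ideal.pow_mem_pow ?_ m), pow_ne_zero _ ?_, ?_⟩
  · refine (Submodule.mem_iInf _).2 fun i => ?_
    have h1 : formX (coords (P i)) ∈ pointIdeal (P i) :=
      Ideal.subset_span (by simp [formX, coords])
    exact Ideal.mem_of_dvd _ (Finset.dvd_prod_of_mem _ (Finset.mem_univ i))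
      (Ideal.mul_mem_right _ _ h1)
  · exact Finset.prod_ne_zero_iff.2 fun i _ => mul_ne_zero (formX_ne_zero _) (formY_ne_zero _)
  · simpa [IsForm] using IsWeightedHomogeneous.pow hf m

end Forms

/-! ### Descent of the data to a finitely generated subring -/

section Descent

variable {K : Type*} [Field K]

theorem exists_map_subtype_eq {σ : Type*} (B : Subring K) {f : MvPolynomial σ K}
    (h : (f.coeffs : Set K) ⊆ B) : ∃ g : MvPolynomial σ B, map B.subtype g = f :=
  mem_range_map_iff_coeffs_subset.2 (by simpa using h)

theorem map_subtype_injective {σ : Type*} (B : Subring K) :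
    Function.Injective (map B.subtype : MvPolynomial σ B → MvPolynomial σ K) :=
  map_injective _ B.subtype_injective

/-- Membership in a power of the ideal of a point only involves finitely many coefficients. -/
theorem exists_finite_descent_pow (z : Fin 2 ⊕ Fin 2 → K) (m : ℕ) :
    ∀ f ∈ coneIdeal z ^ m, ∃ S : Set K, S.Finite ∧ ∀ B : Subring K, S ⊆ B →
      ∀ z' : Fin 2 ⊕ Fin 2 → B, B.subtype ∘ z' = z →
        ∃ f' ∈ coneIdeal z' ^ m, map B.subtype f' = f := by
  induction m with
  | zero =>
    intro f _
    refine ⟨f.coeffs, f.coeffs.finite_toSet, fun B hB z' _ => ?_⟩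
    obtain ⟨g, hg⟩ := exists_map_subtype_eq B hB
    exact ⟨g, by simp, hg⟩
  | succ m ih =>
    intro f hf
    have hsucc : coneIdeal z ^ (m + 1) = coneIdeal z ^ m * Ideal.span {formX z} ⊔
        coneIdeal z ^ m * Ideal.span {formY z} := by
      rw [pow_succ, ← Ideal.mul_sup, ← Ideal.span_insert, coneIdeal]
    rw [hsucc] at hf
    obtain ⟨_, hf₁, _, hf₂, rfl⟩ := Submodule.mem_sup.1 hf
    obtain ⟨g, hg, rfl⟩ := Ideal.mem_mul_span_singleton.1 hf₁
    obtain ⟨h, hh, rfl⟩ := Ideal.mem_mul_span_singleton.1 hf₂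
    obtain ⟨S, hS, hSg⟩ := ih g hg
    obtain ⟨T, hT, hTh⟩ := ih h hh
    refine ⟨S ∪ T, hS.union hT, fun B hB z' hz => ?_⟩
    obtain ⟨g', hg', rfl⟩ := hSg B (Set.subset_union_left.trans hB) z' hz
    obtain ⟨h', hh', rfl⟩ := hTh B (Set.subset_union_right.trans hB) z' hz
    refine ⟨g' * formX z' + h' * formY z', ?_, ?_⟩
    · rw [pow_succ]
      exact add_mem (Ideal.mul_mem_mul hg' (Ideal.subset_span (Or.inl rfl)))
        (Ideal.mul_mem_mul hh' (Ideal.subset_span (Or.inr rfl)))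
    · rw [map_add, map_mul, map_mul, map_formX, map_formY, hz]

/-- If no nonzero form of bi-degree `(n, n)` vanishes at the given points, then forms of bi-degree
`(n, n)` are recovered from their values at the points by an interpolation formula. -/
theorem exists_interpolation {ι : Type*} [Fintype ι] {z : ι → Fin 2 ⊕ Fin 2 → K} {n : ℕ}
    (hn : ∀ G : CoordRing K, IsForm G n n → (∀ i, eval (z i) G = 0) → G = 0) :
    ∃ l : ι → CoordRing K, ∀ G, IsForm G n n → G = ∑ i, C (eval (z i) G) * l i := by
  classical
  let V := weightedHomogeneousSubmodule K bidegree (n, n)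
  let ev : V →ₗ[K] (ι → K) := LinearMap.pi fun i => (aeval (z i)).toLinearMap ∘ₗ V.subtype
  have hev : ∀ G i, ev G i = eval (z i) (G : CoordRing K) := fun G i => by
    simp [ev, aeval_eq_eval]
  obtain ⟨L, hL⟩ := ev.exists_leftInverse_of_injective (LinearMap.ker_eq_bot'.2 fun G hG =>
    Subtype.ext (hn G.1 G.2 fun i => by rw [← hev, hG, Pi.zero_apply]))
  refine ⟨fun i => L (Pi.single i 1), fun G hG => ?_⟩
  have h1 : L (ev ⟨G, hG⟩) = ⟨G, hG⟩ := LinearMap.congr_fun hL _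
  have h2 : ev ⟨G, hG⟩ = ∑ i, eval (z i) G • Pi.single i (1 : K) := by
    ext j
    simp [hev, Finset.sum_apply, Pi.single_apply]
  rw [h2, map_sum] at h1
  simpa [smul_eq_C_mul] using (congrArg Subtype.val h1).symm

end Descent

/-! ### The bound over an arbitrary field -/

/-- Over any field, if no nonzero form of bi-degree `(n, n)` vanishes at the given points, then a
form of bi-degree `(d, d)` vanishing to order `m` at all of them satisfies `m * (n + 1) ≤ 2 * d`.
All hypotheses are witnessed by finitely many elements of the field, so they specialize to positive
characteristic. -/
theorem mul_succ_le {K : Type u} [Field K] {ι : Type*} [Fintype ι] {z : ι → Fin 2 ⊕ Fin 2 → K}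
    {m n d : ℕ} (hm : 0 < m)
    (hn : ∀ G : CoordRing K, IsForm G n n → (∀ i, eval (z i) G = 0) → G = 0)
    {F : CoordRing K} (hF0 : F ≠ 0) (hF : IsForm F d d) {s : ι → CoordRing K}
    (hs : ∀ i, coneMap (z i) (s i) ≠ 0) (hsF : ∀ i, s i * F ∈ coneIdeal (z i) ^ m) :
    m * (n + 1) ≤ 2 * d := by
  obtain ⟨l, hl⟩ := exists_interpolation hn
  choose T hT hTF using fun i => exists_finite_descent_pow (z i) m _ (hsF i)
  let S : Set K := F.coeffs ∪ ⋃ i, (Set.range (z i) ∪ (s i).coeffs ∪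
    (coneMap (z i) (s i)).coeffs ∪ (l i).coeffs ∪ T i)
  have hS : S.Finite := F.coeffs.finite_toSet.union (Set.finite_iUnion fun i =>
    ((((Set.finite_range _).union (s i).coeffs.finite_toSet).union
      (coneMap (z i) (s i)).coeffs.finite_toSet).union (l i).coeffs.finite_toSet).union (hT i))
  obtain ⟨B, k, _, _, p, _, _, θ, hSB, hθ⟩ := exists_specialization S hS
  have hSi : ∀ i, Set.range (z i) ∪ (s i).coeffs ∪ (coneMap (z i) (s i)).coeffs ∪ (l i).coeffs ∪
      T i ⊆ S := fun i =>
    (Set.subset_iUnion (fun i => Set.range (z i) ∪ (s i).coeffs ∪ (coneMap (z i) (s i)).coeffs ∪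
      (l i).coeffs ∪ T i) i).trans Set.subset_union_right
  obtain ⟨F', hF'⟩ := exists_map_subtype_eq B (Set.subset_union_left.trans hSB)
  have hz : ∀ i, ∃ w : Fin 2 ⊕ Fin 2 → B, B.subtype ∘ w = z i := fun i =>
    ⟨fun v => ⟨z i v, hSB (hSi i (by simp))⟩, rfl⟩
  choose w hw using hz
  choose s' hs' using fun i => exists_map_subtype_eq B (f := s i)
    (Set.Subset.trans (fun x hx => by simp [show x ∈ (s i).coeffs from hx]) ((hSi i).trans hSB))
  choose l' hl' using fun i => exists_map_subtype_eq B (f := l i)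
    (Set.Subset.trans (fun x hx => by simp [show x ∈ (l i).coeffs from hx]) ((hSi i).trans hSB))
  choose f' hf' hff' using fun i => hTF i B
    ((Set.subset_union_right.trans (hSi i)).trans hSB) (w i) (hw i)
  -- Nonzero polynomials with coefficients in `S` remain nonzero after specialization.
  have hne : ∀ {τ : Type} (g : MvPolynomial τ B), map B.subtype g ≠ 0 →
      ((map B.subtype g).coeffs : Set K) ⊆ S → map θ g ≠ 0 := by
    intro τ g hg hgS
    obtain ⟨α, hα⟩ := MvPolynomial.ne_zero_iff.1 hg
    refine MvPolynomial.ne_zero_iff.2 ⟨α, ?_⟩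
    rw [coeff_map]
    refine hθ _ (hgS (coeff_mem_coeffs α hα)) fun h => hα ?_
    rw [coeff_map, h, map_zero]
  refine mul_succ_le_of_charP p (z := fun i => θ ∘ w i) (F := map θ F') (s := fun i => map θ (s' i))
    hm ?_ (hne F' (hF' ▸ hF0) (hF' ▸ Set.subset_union_left)) ?_ ?_ ?_
  · -- The interpolation formula survives the specialization.
    have hmon : ∀ α, Finsupp.weight bidegree α = (n, n) →
        (monomial α 1 : MvPolynomial _ B) = ∑ i, C (eval (w i) (monomial α 1)) * l' i := by
      intro α hα
      refine map_subtype_injective B ?_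
      have := hl (monomial α 1) (isWeightedHomogeneous_monomial _ _ _ hα)
      simp only [map_sum, map_mul, map_C, hl', map_monomial, map_one]
      refine this.trans (Finset.sum_congr rfl fun i _ => ?_)
      rw [← hw i, eval_monomial, eval_monomial]
      simp [Finsupp.prod]
    have hint : ∀ G : MvPolynomial (Fin 2 ⊕ Fin 2) k, IsWeightedHomogeneous bidegree G (n, n) →
        G = ∑ i, C (eval (θ ∘ w i) G) * map θ (l' i) := by
      intro G hG
      induction hG using IsWeightedHomogeneous.induction_on with
      | zero => simp
      | add f g hf hg ihf ihg =>
        conv_lhs => rw [ihf, ihg]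
        simp only [map_add, add_mul, Finset.sum_add_distrib]
      | monomial α r hα =>
        have h1 := congrArg (fun g => C r * map θ g) (hmon α hα)
        simp only [map_monomial, C_mul_monomial, map_one, mul_one, map_sum, map_mul, map_C] at h1
        refine h1.trans ?_
        rw [Finset.mul_sum]
        refine Finset.sum_congr rfl fun i _ => ?_
        rw [← mul_assoc, ← C_mul, eval_monomial, eval_monomial]
        simp [Finsupp.prod]
    intro G hG h0
    rw [hint G hG]
    simp [h0]
  · intro α hα
    refine hF (d := α) ?_
    rw [← hF', coeff_map]
    rw [coeff_map] at hα
    exact fun h => hα (by rw [(map_eq_zero_iff _ B.subtype_injective).1 h, map_zero])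
  · intro i
    have h1 : map B.subtype (coneMap (w i) (s' i)) = coneMap (z i) (s i) := by
      rw [map_coneMap, hw, hs']
    rw [← map_coneMap]
    refine hne _ (h1 ▸ hs i) (h1 ▸ Set.Subset.trans (fun x hx => ?_) (hSi i))
    simp [show x ∈ (coneMap (z i) (s i)).coeffs from hx]
  · intro i
    have h1 : f' i = s' i * F' := map_subtype_injective B (by rw [hff', map_mul, hs', hF'])
    have h2 := Ideal.mem_map_of_mem (map θ) (hf' i)
    rw [h1, map_mul, Ideal.map_pow, coneIdeal, Ideal.map_span, Set.image_pair, map_formX,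
      map_formY] at h2
    exact h2

/-- The bound `m * α*(I) ≤ 2 * α*(I^(m))` for the ideal `I` of distinct points. -/
theorem mul_alphaStar_le {K : Type*} [Field K] {s : ℕ} {P : Fin s → X K}
    (hP : Function.Injective P) {m : ℕ} (hm : 0 < m) :
    m * alphaStar (⨅ j, pointIdeal (P j)) ≤
      2 * alphaStar (symbolicPower (⨅ j, pointIdeal (P j)) m) := by
  obtain ⟨F, hFI, hF0, hF⟩ := exists_form_alphaStar (exists_form_mem_symbolicPower P m)
  cases hn : alphaStar (⨅ j, pointIdeal (P j)) with
  | zero => simp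
  | succ n =>
    choose g hg hgF using exists_mul_mem_pow_of_mem_symbolicPower hP hFI
    refine mul_succ_le hm (z := fun i => coords (P i)) (fun G hG h0 => ?_) hF0 hF hg hgF
    by_contra hG0
    have := alphaStar_le ((Submodule.mem_iInf _).2 fun i =>
      (mem_pointIdeal_iff_eval_eq_zero (P i) hG).2 (h0 i)) hG0 hG
    omega

theorem alphaStar_symbolicPower_add_le {K : Type*} [Field K] {s : ℕ} (P : Fin s → X K)
    (m n : ℕ) : alphaStar (symbolicPower (⨅ j, pointIdeal (P j)) (m + n)) ≤
      alphaStar (symbolicPower (⨅ j, pointIdeal (P j)) m) +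
        alphaStar (symbolicPower (⨅ j, pointIdeal (P j)) n) := by
  obtain ⟨f, hfI, hf0, hf⟩ := exists_form_alphaStar (exists_form_mem_symbolicPower P m)
  obtain ⟨g, hgI, hg0, hg⟩ := exists_form_alphaStar (exists_form_mem_symbolicPower P n)
  exact alphaStar_le (mul_mem_symbolicPower hfI hgI) (mul_ne_zero hf0 hg0) (hf.mul hg)

end BiProj

end

theorem mainTheorem4 {K : Type*} [Field K] {s : ℕ} (P : Fin s → BiProj.X K)
    (hP : Function.Injective P) (I : Ideal (BiProj.CoordRing K))
    (hI : I = ⨅ i, BiProj.pointIdeal (P i)) :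
    (∀ m : ℕ, 1 ≤ m →
      (BiProj.alphaStar (symbolicPower I m) : ℝ) / m ≥ (BiProj.alphaStar I : ℝ) / 2) ∧
    Filter.Tendsto (fun m : ℕ => (BiProj.alphaStar (symbolicPower I m) : ℝ) / m)
      Filter.atTop (nhds (BiProj.waldschmidtStar I)) ∧
    BiProj.waldschmidtStar I ≥ (BiProj.alphaStar I : ℝ) / 2 := by
  subst hI
  have hbound : ∀ m : ℕ, 1 ≤ m →
      (BiProj.alphaStar (symbolicPower (⨅ i, BiProj.pointIdeal (P i)) m) : ℝ) / m ≥
        (BiProj.alphaStar (⨅ i, BiProj.pointIdeal (P i)) : ℝ) / 2 := by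
    intro m hm
    rw [ge_iff_le, div_le_div_iff₀ two_pos (by exact_mod_cast hm)]
    have := BiProj.mul_alphaStar_le hP hm
    rw [mul_comm, mul_comm _ (2 : ℝ)]
    exact_mod_cast this
  have hsub : Subadditive fun m : ℕ =>
      (BiProj.alphaStar (symbolicPower (⨅ i, BiProj.pointIdeal (P i)) m) : ℝ) := by
    intro m n
    beta_reduce
    exact_mod_cast BiProj.alphaStar_symbolicPower_add_le P m n
  have hlim := hsub.tendsto_lim ⟨0, by rintro _ ⟨m, rfl⟩; positivity⟩
  have htendsto := tendsto_nhds_limUnder ⟨_, hlim⟩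
  exact ⟨hbound, htendsto,
    ge_of_tendsto htendsto (Filter.eventually_atTop.2 ⟨1, fun m hm => hbound m hm⟩)⟩
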